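/- **Setting.** *Logic.* $\mathrm{Pids}$ is a set of process indices; each $i\in\mathrm{Pids}$ has a set $AP_i$ of atomic propositions (disjoint for different $i$), and a local state of $i$ is a truth assignment to $AP_i$. $\mathrm{ACTL}^-$ formulae are generated from $\mathit{true},\mathit{false},p,\neg p$ ($p$ atomic) by $\wedge,\vee,\mathsf A[f\,\mathsf U\,g],\mathsf A[f\,\mathsf U_w\,g]$ (no nexttime); $\mathsf{AF}f$ is $\mathsf A[\mathit{true}\,\mathsf U f]$. $\mathrm{ACTL}^-_{ij}$ is the set of those with atomic propositions in $AP_i\cup AP_j$; $CL(f)$ is the set of all subformulae of $f$, including $f$. Formulae are interpreted over structures with labelled transitions; a fullpath is a maximal (finite or infinite) path. On a fullpath, $f\,\mathsf U\,g$ means that some state satisfies $g$ and all earlier ones satisfy $f$; $f\,\mathsf U_w\,g$ means that every state up to which (inclusive) no state satisfies $g$ satisfies $f$. $\models$ quantifies over all fullpaths; for a set $\Phi$ of "fair" fullpaths, $\models_\Phi$ is the same relation with all path quantifiers (nested ones too) restricted to fair fullpaths. $\overset{\infty}{\mathsf G}$ is "eventually always", $\overset{\infty}{\mathsf F}$ "infinitely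 often"; $ex_i$ holds at a position of a path iff there is a next transition and it is by process $i$. *Pair-programs.* For $i\ne j$, a pair-program for $\{i,j\}$ consists of a synchronization skeleton $P_i^j$ of $i$, one $P_j^i$ of $j$, and a set $S^0_{ij}$ of initial states. An $ij$-state consists of a node of $P_i^j$, a node of $P_j^i$ and values of the variables shared by $i,j$ (different pairs have disjoint sets of shared variables). A skeleton is a directed graph on local states, every node having an outgoing arc, with at most one arc from any node to any node; an arc is labelled by finitely many guarded commands $B_\ell\to A_\ell$, where $B_\ell$ is a predicate on $ij$-states and $A_\ell$ a deterministic parallel assignment to the shared variables; the guard of the arc is $\bigvee_\ell B_\ell$. In the pair-structure $M_{ij}$ a transition by $h\in\{i,j\}$ follows an arc of $h$ from its current local state, executes some $A_\ell$ with $B_\ell$ true, and leaves the local state of the other process unchanged. The pair-program satisfies $f$ iff $M_{ij},s_0\models f$ for all $s_0\in S^0_{ij}$. An $ij$-state is reachable iff it lies on a path of $M_{ij}$ from $S^0_{ij}$. *Dynamic programs.* A pair-specification is $\langle\{i,j\},spec_{ij}\rangle$ with $i\neq j$, $spec_{ij}\in\mathrm{ACTL}^-_{ij}$. A dynamic specification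 is a set $\mathcal{UI}$ of pair-specifications, a finite $\mathcal I_0\subseteq\mathcal{UI}$ and a map $create:2^{\mathcal{UI}}\to2^{\mathcal{UI}}$. A synthesis method determines, for each pair-specification, a set of admissible pair-programs for its pair. A configuration $s$ consists of a set $s.\mathcal I\subseteq\mathcal{UI}$ of pair-specifications in force and, for each pair $\{i,j\}\in \mathrm{pairs}(s)$ (the pairs occurring in $s.\mathcal I$), one active pair-program and one $ij$-state $s{\restriction}ij$ of it, such that all pair-states agree on the local state $s{\restriction}i$ of a common process $i$, and all active pair-programs have the same unlabelled skeleton graph for a common process. $\mathrm{procs}(s)$ is the set of processes occurring in $\mathrm{pairs}(s)$. $M_{\mathcal P}$ has as states the configurations reachable, by the transitions below, from the initial ones: $s.\mathcal I=\mathcal I_0$, the pair-programs are admissible for and satisfy their specifications, and $s{\restriction}ij\in S^0_{ij}$ for all pairs. A *normal* transition $s\to t$ by $i\in\mathrm{procs}(s)$ is, for every $\{i,j\}\in\mathrm{pairs}(s)$, a transition by $i$ in $M_{ij}$ from $s{\restriction}ij$ to $t{\restriction}ij$, and changes nothing else. A *create* transition adds to $s.\mathcal I$ one element $\langle\{i,j\},spec_{ij}\rangle$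 of $create(s.\mathcal I)$ with $\{i,j\}\notin\mathrm{pairs}(s)$, and adds for it an admissible pair-program satisfying $spec_{ij}$, in a reachable $ij$-state that agrees with $s$ on the local states of $i$ and of $j$ if already present; nothing else changes. An atomic proposition in $AP_i$, $i\in\mathrm{procs}(s)$, has at $s$ its value in $s{\restriction}i$. *Wait-for-graph.* Process $P_i$ in configuration $s$ has an arc $a_i$ from one local state to another iff $P_i^j$ has one for all $\{i,j\}\in\mathrm{pairs}(s)$. $W(s)$ is the directed graph whose nodes are the processes $P_i$, $i\in\mathrm{procs}(s)$, and their arcs $a_i$ starting in $s{\restriction}i$; there is an edge $P_i\to a_i$ for each such arc, and an edge $a_i\to P_j$ iff $\{i,j\}\in\mathrm{pairs}(s)$ and the guard of $a_i$ in $P_i^j$ is false at $s{\restriction}ij$. A supercycle in $W(s)$ is a nonempty subgraph $SC$ such that for $P_i\in SC$ all edges $P_i\to a_i$ of $W(s)$ are in $SC$, and for each $a_i\in SC$ some edge $a_i\to P_j$ of $W(s)$ is in $SC$. $\mathcal W_{ij}(s)$ is the set of all $k$ such that $W(s)$ has a path from $P_i$ or $P_j$ to $P_k$. *Fairness.* $en_i$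 holds at $s$ iff some arc $a_i$ in $W(s)$ has no outgoing edge. A local state of $i$ is sometimes-blocking in $M_{ij}$ iff some state on some fullpath of $M_{ij}$ from $S^0_{ij}$ has this local state of $i$ and a false guard on some arc of $P_j^i$ starting in the local state of $j$; $blk_i$ holds at $s$ iff $s{\restriction}i$ is sometimes-blocking in $M_{ij}$ for some $\{i,j\}\in\mathrm{pairs}(s)$. $pnd_{ij}$ holds at $s$ iff $\{i,j\}\in\mathrm{pairs}(s)$ and there is $f\in CL(spec_{ij})$, for a specification $spec_{ij}$ of $\{i,j\}$ in force, with $M_{ij},s{\restriction}ij\not\models f$ and $M_{ij},s{\restriction}ij\models\mathsf{AF}f$. A fullpath $\pi$ of $M_{\mathcal P}$ is fair ($\pi \in\Phi$) iff (weak blocking) for every $i$ in $\mathrm{procs}$ of some configuration along $\pi$, $\overset{\infty}{\mathsf G}(blk_i\wedge en_i)\Rightarrow\overset{\infty}{\mathsf F}ex_i$; (weak eventuality) for every pair $\{i,j\}$ of some configuration along $\pi$, $(\overset{\infty}{\mathsf G}en_i\vee\overset{\infty}{\mathsf G}en_j)\wedge\overset{\infty}{\mathsf G}pnd_{ij}\Rightarrow\overset{\infty}{\mathsf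 F}(ex_i\vee ex_j)$; (creation) $\pi$ contains infinitely many normal transitions. *Liveness condition.* (a) For every reachable configuration $s$ and all $i,j$ with $\{i,j\}\in\mathrm{pairs}(s)$: $M_{ij},S^0_{ij}\models\mathsf{AG}\,\mathsf A(\mathsf G\,ex_i\Rightarrow\overset{\infty}{\mathsf G}aen_j)$, where $aen_j$ says that every arc of $P_j^i$ starting in the current local state of $j$ has a true guard. (b) For every reachable $s$ and $\{i,j\}\in\mathrm{pairs}(s)$ with $pnd_{ij}$ true at $s$ there is a finite $W\subseteq\mathrm{Pids}$ such that $\mathcal W_{ij}(t)\subseteq W$ for all $t$ reachable from $s$ along paths all of whose configurations satisfy $pnd_{ij}$. **Theorem (Large model).** Let $s$ be a reachable configuration of $M_{\mathcal P}$ with $\langle\{i,j\},spec_{ij}\rangle\in s.\mathcal I$. Assume that the liveness condition holds, and that $W(u)$ has no supercycle for every reachable configuration $u$. Then for every $f_{ij}\in CL(spec_{ij})$ with $M_{ij},s{\restriction}ij\models f_{ij}$, where $M_{ij}$ is the structure of the pair-program active for $\{i,j\}$ in $s$, we have $M_{\mathcal P},s\models_\Phi f_{ij}$. -/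

import Mathlib

universe u v w x

namespace DynProg

/-! ## Nexttime-free ACTL, structures, paths, satisfaction -/

/-- Formulae of ACTL without the nexttime modality, over the atomic propositions `α`.
Negation is applied to atomic propositions only. -/
inductive ACTL (α : Type u) : Type u
  | tt : ACTL α
  | ff : ACTL α
  | atom (p : α) : ACTL α
  | natom (p : α) : ACTL α
  | and (f g : ACTL α) : ACTL α
  | or (f g : ACTL α) : ACTL α
  /-- strong until: `A[f U g]` -/
  | AU (f g : ACTL α) : ACTL α
  /-- weak until: `A[f U_w g]` -/
  | AW (f g : ACTL α) : ACTL α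

namespace ACTL

variable {α : Type u}

/-- `AF f`, i.e. `A[true U f]`. -/
def AF (f : ACTL α) : ACTL α := AU tt f

/-- The atomic propositions occurring in a formula. -/
def atoms : ACTL α → Set α
  | tt => ∅
  | ff => ∅
  | atom p => {p}
  | natom p => {p}
  | and f g => f.atoms ∪ g.atoms
  | or f g => f.atoms ∪ g.atoms
  | AU f g => f.atoms ∪ g.atoms
  | AW f g => f.atoms ∪ g.atoms

/-- `CL f`: the set of all subformulae of `f`, including `f` itself. -/
def CL : ACTL α → Set (ACTL α)
  | tt => {tt}
  | ff => {ff}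
  | atom p => {atom p}
  | natom p => {natom p, atom p}
  | and f g => insert (and f g) (f.CL ∪ g.CL)
  | or f g => insert (or f g) (f.CL ∪ g.CL)
  | AU f g => insert (AU f g) (f.CL ∪ g.CL)
  | AW f g => insert (AW f g) (f.CL ∪ g.CL)

end ACTL

/-- A structure with labelled transitions. `val s p b` says that the atomic proposition `p`
has the truth value `b` in the state `s`. It is a relation since a state need not assign a value
to every atomic proposition (only to those of the processes which it comprises). -/
structure Kripke (State : Type u) (Atom : Type v) (Label : Type w) where
  R : State → Label → State → Prop
  val : State → Atom → Bool → Prop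

/-- A nonempty, finite or infinite, sequence of states linked by labels. `len` is the number of
transitions; only the states `st n` with `n ≤ len` and the labels `lab n` with `n < len`
belong to the sequence. -/
structure LPath (State : Type u) (Label : Type v) where
  len : ℕ∞
  st : ℕ → State
  lab : ℕ → Label

namespace LPath

variable {State : Type u} {Label : Type v}

/-- The linear-time modality `F∞` (infinitely often, `GF`) for an assertion on positions. -/
def InfOften (π : LPath State Label) (φ : ℕ → Prop) : Prop :=
  ∀ n : ℕ, (n : ℕ∞) ≤ π.len → ∃ m : ℕ, n ≤ m ∧ (m : ℕ∞) ≤ π.len ∧ φ m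

/-- The linear-time modality `G∞` (eventually always, `FG`) for an assertion on positions. -/
def AlmostAlways (π : LPath State Label) (φ : ℕ → Prop) : Prop :=
  ∃ n : ℕ, (n : ℕ∞) ≤ π.len ∧ ∀ m : ℕ, n ≤ m → (m : ℕ∞) ≤ π.len → φ m

/-- The linear-time modality `G` (always) for an assertion on positions. -/
def Always (π : LPath State Label) (φ : ℕ → Prop) : Prop :=
  ∀ n : ℕ, (n : ℕ∞) ≤ π.len → φ n

/-- At position `n` there is a next transition, and it carries the label `l`. -/
def TakesLabel (π : LPath State Label) (l : Label) (n : ℕ) : Prop :=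
  (n : ℕ∞) < π.len ∧ π.lab n = l

end LPath

namespace Kripke

variable {State : Type u} {Atom : Type v} {Label : Type w}

/-- A fullpath from `s`: a maximal path of the structure whose first state is `s`. -/
def IsFullpathFrom (M : Kripke State Atom Label) (s : State) (π : LPath State Label) : Prop :=
  π.st 0 = s ∧
  (∀ n : ℕ, (n : ℕ∞) < π.len → M.R (π.st n) (π.lab n) (π.st (n + 1))) ∧
  (∀ n : ℕ, π.len = (n : ℕ∞) → ∀ l t, ¬ M.R (π.st n) l t)

/-- `t` lies on some path that starts in `s`. -/
def Reaches (M : Kripke State Atom Label) : State → State → Prop :=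
  Relation.ReflTransGen (fun s t => ∃ l, M.R s l t)

/-- Satisfaction of a state formula when path quantification ranges over the fullpaths `π` with
`Fair π` only. -/
def FairSat (M : Kripke State Atom Label) (Fair : LPath State Label → Prop) :
    ACTL Atom → State → Prop
  | .tt, _ => True
  | .ff, _ => False
  | .atom p, s => M.val s p true
  | .natom p, s => M.val s p false
  | .and f g, s => M.FairSat Fair f s ∧ M.FairSat Fair g s
  | .or f g, s => M.FairSat Fair f s ∨ M.FairSat Fair g s
  | .AU f g, s => ∀ π, M.IsFullpathFrom s π → Fair π →
      ∃ n : ℕ, (n : ℕ∞) ≤ π.len ∧ M.FairSat Fair g (π.st n) ∧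
        ∀ m : ℕ, m < n → M.FairSat Fair f (π.st m)
  | .AW f g, s => ∀ π, M.IsFullpathFrom s π → Fair π →
      ∀ n : ℕ, (n : ℕ∞) ≤ π.len → (∀ m : ℕ, m ≤ n → ¬ M.FairSat Fair g (π.st m)) →
        M.FairSat Fair f (π.st n)

/-- Ordinary satisfaction: path quantification ranges over all fullpaths. -/
def Sat (M : Kripke State Atom Label) (f : ACTL Atom) (s : State) : Prop :=
  M.FairSat (fun _ => True) f s

/-- `EF φ` for an assertion `φ` on states. -/
def EF (M : Kripke State Atom Label) (φ : State → Prop) (s : State) : Prop :=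
  ∃ π, M.IsFullpathFrom s π ∧ ∃ n : ℕ, (n : ℕ∞) ≤ π.len ∧ φ (π.st n)

/-- `AG φ` for an assertion `φ` on states. -/
def AG (M : Kripke State Atom Label) (φ : State → Prop) (s : State) : Prop :=
  ∀ π, M.IsFullpathFrom s π → π.Always (fun n => φ (π.st n))

end Kripke

/-! ## Pair-programs -/

/-- The basic data: process indices, the atomic propositions of each process, and the shared
variables of each pair of processes together with their domains. The propositions of different
processes, and the shared variables of different pairs, are disjoint by construction. -/
structure Signature where
  Pid : Type u
  AP : Pid → Type v
  Var : Sym2 Pid → Type w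
  Val : (e : Sym2 Pid) → Var e → Type x

variable {Sg : Signature.{u, v, w, x}}

/-- All atomic propositions. -/
abbrev Signature.Atom (Sg : Signature.{u, v, w, x}) : Type (max u v) := Σ i : Sg.Pid, Sg.AP i

/-- Local states of process `i`: truth assignments to its atomic propositions. -/
abbrev Signature.LocalState (Sg : Signature.{u, v, w, x}) (i : Sg.Pid) : Type v := Sg.AP i → Bool

/-- Values of all the shared variables of the pair `e`. -/
abbrev Signature.Shared (Sg : Signature.{u, v, w, x}) (e : Sym2 Sg.Pid) : Type (max w x) :=
  (y : Sg.Var e) → Sg.Val e y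

/-- Tuples consisting of a local state for each process in the pair `e` and of values for the
shared variables of the pair. -/
structure PairState (Sg : Signature.{u, v, w, x}) (e : Sym2 Sg.Pid) where
  loc : (h : {h : Sg.Pid // h ∈ e}) → Sg.LocalState h
  shared : Sg.Shared e

/-- A guarded command `B → A` of a pair-program: the guard is a predicate on pair-states, the body
a (deterministic, terminating) parallel assignment to the shared variables. -/
structure GuardedCommand (Sg : Signature.{u, v, w, x}) (e : Sym2 Sg.Pid) where
  guard : PairState Sg e → Prop
  body : Sg.Shared e → Sg.Shared e

/-- The label of an arc: a disjunction of finitely many guarded commands. -/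
abbrev ArcLabel (Sg : Signature.{u, v, w, x}) (e : Sym2 Sg.Pid) := List (GuardedCommand Sg e)

/-- The guard of an arc with this label: one of the guards of the label holds. -/
def ArcLabel.guard {e : Sym2 Sg.Pid} (L : ArcLabel Sg e) (s : PairState Sg e) : Prop :=
  ∃ c ∈ L, c.guard s

/-- Executing the label in `s` is possible and can leave the shared variables with the
values `z`. -/
def ArcLabel.Exec {e : Sym2 Sg.Pid} (L : ArcLabel Sg e) (s : PairState Sg e) (z : Sg.Shared e) :
    Prop :=
  ∃ c ∈ L, c.guard s ∧ c.body s.shared = z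

/-- The synchronization skeleton of process `h` within a pair-program for the pair `e`: a directed
graph whose nodes are local states, with at most one (labelled) arc from a node to a node, and
with at least one arc leaving each node. `label a b = none` says that there is no arc. -/
structure Skeleton (Sg : Signature.{u, v, w, x}) (e : Sym2 Sg.Pid) (h : Sg.Pid) where
  nodes : Set (Sg.LocalState h)
  label : Sg.LocalState h → Sg.LocalState h → Option (ArcLabel Sg e)
  label_nodes : ∀ a b L, label a b = some L → a ∈ nodes ∧ b ∈ nodes
  no_dead_end : ∀ a ∈ nodes, ∃ b L, label a b = some L

/-- The skeleton with all arc labels removed: its nodes, and its arcs as a relation. -/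
def Skeleton.graph {e : Sym2 Sg.Pid} {h : Sg.Pid} (P : Skeleton Sg e h) :
    Set (Sg.LocalState h) × (Sg.LocalState h → Sg.LocalState h → Prop) :=
  (P.nodes, fun a b => ∃ L, P.label a b = some L)

/-- A pair-program for the pair `e`: a skeleton for each of the processes, and a set of initial
states. -/
structure PairProgram (Sg : Signature.{u, v, w, x}) (e : Sym2 Sg.Pid) where
  skel : (h : {h : Sg.Pid // h ∈ e}) → Skeleton Sg e h
  init : Set (PairState Sg e)
  init_nodes : ∀ s ∈ init, ∀ h, s.loc h ∈ (skel h).nodes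

namespace PairProgram

variable {e : Sym2 Sg.Pid}

/-- The states of the pair-program: each process is at a node of its skeleton. -/
def IsState (P : PairProgram Sg e) (s : PairState Sg e) : Prop :=
  ∀ h, s.loc h ∈ (P.skel h).nodes

/-- The pair-structure `M_ij`: the global state transition diagram of the pair-program executing
in isolation. -/
def toKripke (P : PairProgram Sg e) : Kripke (PairState Sg e) Sg.Atom Sg.Pid where
  R s h t := P.IsState s ∧ P.IsState t ∧ ∃ hh : h ∈ e,
    (∃ L, (P.skel ⟨h, hh⟩).label (s.loc ⟨h, hh⟩) (t.loc ⟨h, hh⟩) = some L ∧ L.Exec s t.shared) ∧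
    ∀ k : {k : Sg.Pid // k ∈ e}, (k : Sg.Pid) ≠ h → t.loc k = s.loc k
  val s p b := ∃ hp : p.1 ∈ e, s.loc ⟨p.1, hp⟩ p.2 = b

/-- A reachable state of the pair-program. -/
def Reachable (P : PairProgram Sg e) (s : PairState Sg e) : Prop :=
  ∃ s₀ ∈ P.init, P.toKripke.Reaches s₀ s

/-- The pair-program has the property expressed by `f`. -/
def Satisfies (P : PairProgram Sg e) (f : ACTL Sg.Atom) : Prop :=
  ∀ s₀ ∈ P.init, P.toKripke.Sat f s₀

/-- The local state `a` of process `i` is sometimes-blocking: along some fullpath from an initial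
state, a state occurs where `i` is in the local state `a` and some arc of the other process,
leaving its current local state, has a false guard. -/
def SometimesBlocking (P : PairProgram Sg e) (i : {h : Sg.Pid // h ∈ e})
    (a : Sg.LocalState i) : Prop :=
  ∃ s₀ ∈ P.init, P.toKripke.EF (fun s => s.loc i = a ∧
    ∃ j : {h : Sg.Pid // h ∈ e}, j ≠ i ∧
      ∃ b L, (P.skel j).label (s.loc j) b = some L ∧ ¬ L.guard s) s₀

/-- `aen_j`: every arc of process `j` that leaves its current local state has a true guard. -/
def AllEnabled (P : PairProgram Sg e) (j : {h : Sg.Pid // h ∈ e}) (s : PairState Sg e) : Prop :=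
  ∀ b L, (P.skel j).label (s.loc j) b = some L → L.guard s

/-- For `spec` as specification, the state `s` has a pending eventuality: some subformula of `spec`
is false in `s`, but is true eventually along all fullpaths from `s`. -/
def PendingEventuality (P : PairProgram Sg e) (spec : ACTL Sg.Atom) (s : PairState Sg e) : Prop :=
  ∃ f ∈ spec.CL, ¬ P.toKripke.Sat f s ∧ P.toKripke.Sat f.AF s

end PairProgram

/-! ## Dynamic specifications and configurations -/

/-- A pair-specification: a pair of two different processes, and a nexttime-free ACTL formula over
the atomic propositions of these two processes. -/
structure PairSpec (Sg : Signature.{u, v, w, x}) where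
  pair : Sym2 Sg.Pid
  not_diag : ¬ pair.IsDiag
  spec : ACTL Sg.Atom
  spec_atoms : ∀ p ∈ spec.atoms, p.1 ∈ pair

/-- A dynamic specification: the universal set of pair-specifications, the finite set of those that
are in force initially, and the mapping that determines which ones can be added to those that are
in force. -/
structure DynamicSpec (Sg : Signature.{u, v, w, x}) where
  universal : Set (PairSpec Sg)
  initial : Set (PairSpec Sg)
  initial_finite : initial.Finite
  initial_subset : initial ⊆ universal
  create : Set (PairSpec Sg) → Set (PairSpec Sg)
  create_subset : ∀ I, I ⊆ universal → create I ⊆ universal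

/-- A (possibly nondeterministic) method for the synthesis of pair-programs: it tells which
pair-programs may be used for a pair-specification. That the pair-program satisfies the
specification is demanded where the pair-program is put to use. -/
abbrev SynthesisMethod (Sg : Signature.{u, v, w, x}) :=
  (σ : PairSpec Sg) → Set (PairProgram Sg σ.pair)

/-- The pairs for which a set of pair-specifications has a member. -/
def pairsOf (I : Set (PairSpec Sg)) : Set (Sym2 Sg.Pid) := {e | ∃ σ ∈ I, σ.pair = e}

/-- A (consistent) configuration: the set of pair-specifications in force, and for each of their
pairs the active pair-program and its current state. All pair-states assign the same local state
to a common process, and all active pair-programs have the same unlabelled skeleton for a common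
process. -/
structure Config (D : DynamicSpec Sg) where
  inForce : Set (PairSpec Sg)
  inForce_subset : inForce ⊆ D.universal
  prog : (e : Sym2 Sg.Pid) → e ∈ pairsOf inForce → PairProgram Sg e
  state : (e : Sym2 Sg.Pid) → e ∈ pairsOf inForce → PairState Sg e
  isState : ∀ e he, (prog e he).IsState (state e he)
  consistent : ∀ e he e' he' i (hi : i ∈ e) (hi' : i ∈ e'),
    (state e he).loc ⟨i, hi⟩ = (state e' he').loc ⟨i, hi'⟩
  same_graph : ∀ e he e' he' i (hi : i ∈ e) (hi' : i ∈ e'),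
    ((prog e he).skel ⟨i, hi⟩).graph = ((prog e' he').skel ⟨i, hi'⟩).graph

namespace Config

variable {D : DynamicSpec Sg}

/-- `pairs(s)` -/
abbrev pairs (s : Config D) : Set (Sym2 Sg.Pid) := pairsOf s.inForce

/-- `procs(s)` -/
def procs (s : Config D) : Set Sg.Pid := {i | ∃ e ∈ s.pairs, i ∈ e}

/-- Initial configurations of the program synthesized from `D`. -/
def IsInitial (syn : SynthesisMethod Sg) (s : Config D) : Prop :=
  s.inForce = D.initial ∧
  (∀ σ ∈ D.initial, ∀ hσ : σ.pair ∈ s.pairs,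
    s.prog σ.pair hσ ∈ syn σ ∧ (s.prog σ.pair hσ).Satisfies σ.spec) ∧
  ∀ e (he : e ∈ s.pairs), s.state e he ∈ (s.prog e he).init

/-- Create transitions: a pair-specification for a new pair comes into force, and a pair-program
for it is added, in one of its reachable states, without a change of the state of the existing
pair-programs. -/
def CreateStep (syn : SynthesisMethod Sg) (s t : Config D) : Prop :=
  ∃ σ : PairSpec Sg, σ.pair ∉ s.pairs ∧
    σ ∈ D.create s.inForce ∧
    t.inForce = s.inForce ∪ {σ} ∧
    (∃ hσ : σ.pair ∈ t.pairs,
      t.prog σ.pair hσ ∈ syn σ ∧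
      (t.prog σ.pair hσ).Satisfies σ.spec ∧
      (t.prog σ.pair hσ).Reachable (t.state σ.pair hσ) ∧
      ∀ i (hi : i ∈ σ.pair) e (he : e ∈ s.pairs) (hi' : i ∈ e),
        (t.state σ.pair hσ).loc ⟨i, hi⟩ = (s.state e he).loc ⟨i, hi'⟩) ∧
    ∀ e (hs : e ∈ s.pairs) (ht : e ∈ t.pairs),
      t.prog e ht = s.prog e hs ∧ t.state e ht = s.state e hs

/-- Normal transitions: process `i` executes an arc of the conjunctive overlay of all the
pair-processes of `i` in the active pair-programs. -/
def NormalStep (s : Config D) (i : Sg.Pid) (t : Config D) : Prop :=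
  i ∈ s.procs ∧
  t.inForce = s.inForce ∧
  ∀ e (hs : e ∈ s.pairs) (ht : e ∈ t.pairs),
    t.prog e ht = s.prog e hs ∧
    (∀ hi : i ∈ e, ∃ L,
      ((s.prog e hs).skel ⟨i, hi⟩).label
        ((s.state e hs).loc ⟨i, hi⟩) ((t.state e ht).loc ⟨i, hi⟩) = some L ∧
      L.Exec (s.state e hs) (t.state e ht).shared) ∧
    (∀ j (hj : j ∈ e), j ≠ i → (t.state e ht).loc ⟨j, hj⟩ = (s.state e hs).loc ⟨j, hj⟩) ∧
    (i ∉ e → t.state e ht = s.state e hs)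

/-- Transitions of the synthesized program: the label `some i` marks the normal transitions of
process `i`, the label `none` the create transitions. -/
def Step (syn : SynthesisMethod Sg) (s : Config D) : Option Sg.Pid → Config D → Prop
  | some i, t => s.NormalStep i t
  | none, t => s.CreateStep syn t

/-- The reachable configurations: the closure of the initial configurations under normal and create
transitions. -/
inductive Reachable (syn : SynthesisMethod Sg) : Config D → Prop
  | init {s : Config D} : s.IsInitial syn → Reachable syn s
  | step {s t : Config D} {l : Option Sg.Pid} : Reachable syn s → s.Step syn l t → Reachable syn t

end Config

/-- The structure `M_P`: the global state transition diagram of the synthesized program. -/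
def globalStructure (D : DynamicSpec Sg) (syn : SynthesisMethod Sg) :
    Kripke (Config D) Sg.Atom (Option Sg.Pid) where
  R s l t := s.Reachable syn ∧ t.Reachable syn ∧ s.Step syn l t
  val s p b := ∃ e, ∃ he : e ∈ s.pairs, ∃ hp : p.1 ∈ e, (s.state e he).loc ⟨p.1, hp⟩ p.2 = b

/-! ## Wait-for-graphs -/

/-- Nodes of wait-for-graphs: processes, and arcs of processes, given by their start and finish
local states. -/
inductive WFNode (Sg : Signature.{u, v, w, x}) : Type (max u v)
  | proc (i : Sg.Pid) : WFNode Sg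
  | arc (i : Sg.Pid) (a b : Sg.LocalState i) : WFNode Sg

namespace Config

variable {D : DynamicSpec Sg}

/-- In the configuration `s`, process `i` has an arc from `a` to `b`, i.e. all the pair-processes
of which it is the conjunctive overlay have one, and `a` is the current local state of `i`. -/
def HasArc (s : Config D) (i : Sg.Pid) (a b : Sg.LocalState i) : Prop :=
  i ∈ s.procs ∧ ∀ e (he : e ∈ s.pairs) (hi : i ∈ e),
    (s.state e he).loc ⟨i, hi⟩ = a ∧ ∃ L, ((s.prog e he).skel ⟨i, hi⟩).label a b = some L

/-- The nodes of the wait-for-graph `W(s)`. -/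
def WNode (s : Config D) : WFNode Sg → Prop
  | .proc i => i ∈ s.procs
  | .arc i a b => s.HasArc i a b

/-- The conjunct, for the pair `{i, j}`, of the guard of the arc of `i` from `a` to `b` is false
in `s`. -/
def Blocked (s : Config D) (i : Sg.Pid) (a b : Sg.LocalState i) (j : Sg.Pid) : Prop :=
  ∃ he : s(i, j) ∈ s.pairs, ∃ L,
    ((s.prog s(i, j) he).skel ⟨i, Sym2.mem_mk_left i j⟩).label a b = some L ∧
    ¬ L.guard (s.state s(i, j) he)

/-- The edges of the wait-for-graph `W(s)`. -/
def WEdge (s : Config D) : WFNode Sg → WFNode Sg → Prop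
  | .proc i, .arc k a b => i = k ∧ s.HasArc k a b
  | .arc i a b, .proc j => s.HasArc i a b ∧ s.Blocked i a b j
  | _, _ => False

/-- The graph with vertex set `V` and edge relation `E` is a supercycle in `W(s)`. -/
def IsSupercycle (s : Config D) (V : Set (WFNode Sg)) (E : WFNode Sg → WFNode Sg → Prop) : Prop :=
  (∀ n ∈ V, s.WNode n) ∧
  (∀ m n, E m n → m ∈ V ∧ n ∈ V ∧ s.WEdge m n) ∧
  V.Nonempty ∧
  (∀ i, .proc i ∈ V → ∀ a b, s.HasArc i a b → E (.proc i) (.arc i a b)) ∧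
  (∀ i a b, .arc i a b ∈ V → ∃ j, s.WEdge (.arc i a b) (.proc j) ∧ E (.arc i a b) (.proc j))

/-- `W(s)` is supercycle-free. -/
def SupercycleFree (s : Config D) : Prop := ¬ ∃ V E, s.IsSupercycle V E

/-- The set of processes to which a path in `W(s)` leads from one of the processes in `e`. -/
def blockers (s : Config D) (e : Sym2 Sg.Pid) : Set Sg.Pid :=
  {k | ∃ i ∈ e, Relation.TransGen s.WEdge (.proc i) (.proc k)}

/-! ## Fairness and the liveness condition -/

/-- `en_i`: some arc of process `i` is enabled in `s`. -/
def Enabled (s : Config D) (i : Sg.Pid) : Prop :=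
  ∃ a b, s.HasArc i a b ∧ ∀ e (he : e ∈ s.pairs) (hi : i ∈ e) L,
    ((s.prog e he).skel ⟨i, hi⟩).label a b = some L → L.guard (s.state e he)

/-- `blk_i`: the local state of process `i` is sometimes-blocking in one of the active
pair-programs of `i`. -/
def Blk (s : Config D) (i : Sg.Pid) : Prop :=
  ∃ e, ∃ he : e ∈ s.pairs, ∃ hi : i ∈ e,
    (s.prog e he).SometimesBlocking ⟨i, hi⟩ ((s.state e he).loc ⟨i, hi⟩)

/-- `pnd_ij`: the pair `e = {i, j}` is active, and its pair-state has a pending eventuality. -/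
def Pnd (s : Config D) (e : Sym2 Sg.Pid) : Prop :=
  ∃ he : e ∈ s.pairs, ∃ σ ∈ s.inForce, σ.pair = e ∧
    (s.prog e he).PendingEventuality σ.spec (s.state e he)

end Config

section Fairness

variable {D : DynamicSpec Sg}

/-- `procs(π)` -/
def pathProcs (π : LPath (Config D) (Option Sg.Pid)) : Set Sg.Pid :=
  {i | ∃ n : ℕ, (n : ℕ∞) ≤ π.len ∧ i ∈ (π.st n).procs}

/-- `pairs(π)` -/
def pathPairs (π : LPath (Config D) (Option Sg.Pid)) : Set (Sym2 Sg.Pid) :=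
  {e | ∃ n : ℕ, (n : ℕ∞) ≤ π.len ∧ e ∈ (π.st n).pairs}

/-- Weak blocking fairness. -/
def WeakBlockingFair (π : LPath (Config D) (Option Sg.Pid)) : Prop :=
  ∀ i ∈ pathProcs π,
    π.AlmostAlways (fun n => (π.st n).Blk i ∧ (π.st n).Enabled i) →
    π.InfOften (π.TakesLabel (some i))

/-- Weak eventuality fairness. -/
def WeakEventualityFair (π : LPath (Config D) (Option Sg.Pid)) : Prop :=
  ∀ i j, s(i, j) ∈ pathPairs π →
    (π.AlmostAlways (fun n => (π.st n).Enabled i) ∨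
      π.AlmostAlways (fun n => (π.st n).Enabled j)) ∧
    π.AlmostAlways (fun n => (π.st n).Pnd s(i, j)) →
    π.InfOften (fun n => π.TakesLabel (some i) n ∨ π.TakesLabel (some j) n)

/-- Creation fairness: infinitely many transitions are normal. -/
def CreationFair (π : LPath (Config D) (Option Sg.Pid)) : Prop :=
  π.InfOften (fun n => ∃ i, π.TakesLabel (some i) n)

/-- The overall fairness notion. -/
def Fair (π : LPath (Config D) (Option Sg.Pid)) : Prop :=
  WeakBlockingFair π ∧ WeakEventualityFair π ∧ CreationFair π

/-- The liveness condition for dynamic programs. First, in every active pair-program executing in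
isolation, `AG A(G ex_i → G∞ aen_j)` holds in all initial states. Second, as long as an eventuality
of a pair is pending, the processes that block the pair are confined to a finite set. -/
def LivenessCondition (D : DynamicSpec Sg) (syn : SynthesisMethod Sg) : Prop :=
  (∀ s : Config D, s.Reachable syn → ∀ e (he : e ∈ s.pairs),
    ∀ i j : {h : Sg.Pid // h ∈ e}, i ≠ j → ∀ s₀ ∈ (s.prog e he).init,
      (s.prog e he).toKripke.AG (fun r => ∀ π, (s.prog e he).toKripke.IsFullpathFrom r π →
        π.Always (π.TakesLabel (i : Sg.Pid)) →
        π.AlmostAlways (fun n => (s.prog e he).AllEnabled j (π.st n))) s₀) ∧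
  (∀ s : Config D, s.Reachable syn → ∀ e ∈ s.pairs, s.Pnd e →
    ∃ W : Set Sg.Pid, W.Finite ∧ ∀ t : Config D,
      Relation.ReflTransGen
        (fun p q => p.Pnd e ∧ q.Pnd e ∧ ∃ l, (globalStructure D syn).R p l q) s t →
      t.blockers e ⊆ W)

end Fairness

end DynProg

open DynProg

/-! The proof is by induction on the subformula, for all configurations at once. In the base cases,
a truth value read in the pair-state is also one read in the configuration. The pair-program of
{i,j} sees a run of `M_P` as a path of `M_ij` interleaved with stuttering steps
(`Config.Step.pair`). There is no nexttime, so `Sat.AU_step` and `Sat.AW_step` carry an until across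
each proper transition while its second argument g is false, and stuttering changes nothing. This
safety half settles A[f U_w g]. For A[f U g] it remains to show that g is reached. If it never were,
the eventuality g would stay pending; and if i or j executes infinitely often, the destuttered
projection (`IsRun.exists_projection`) is a fullpath of `M_ij` that avoids g, a contradiction.

The core is therefore `IsRun.frequently_ex`: a pair with a permanently pending eventuality executes
infinitely often. Suppose not. Part (b) of the liveness condition confines the blockers of the pair
to a finite set W. Let A consist of the processes in W or in the pair that execute only finitely
often. As A is finite, all its members are at rest from some position on; the wait-for edges among
them are then frozen, and by part (a) (`IsRun.eventually_not_wEdge`) they no longer wait for members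
of W outside A. So the part of the wait-for-graph reachable from the pair becomes constant. Without
a supercycle it contains an unblocked arc (`SupercycleFree.exists_arc`), whose owner k in A thus
stays enabled forever. If k is in the pair, weak eventuality fairness makes the pair execute
infinitely often; otherwise k blocks some process, `Blk` holds for it, and weak blocking fairness
makes k execute infinitely often. Both are impossible. -/

namespace DynProg

/-! ### Subformulae -/

namespace ACTL

theorem self_mem_CL {α : Type u} (f : ACTL α) : f ∈ f.CL := by
  cases f <;> simp [CL]

theorem CL_subset_of_mem {α : Type u} {f g : ACTL α} (h : f ∈ g.CL) : f.CL ⊆ g.CL := by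
  induction g with
  | tt | ff | atom p =>
    obtain rfl : f = _ := h
    exact subset_rfl
  | natom p =>
    rcases h with rfl | h
    · exact subset_rfl
    · obtain rfl : f = _ := h
      intro x hx
      exact Or.inr hx
  | and a b iha ihb | or a b iha ihb | AU a b iha ihb | AW a b iha ihb =>
    rcases h with rfl | h | h
    · exact subset_rfl
    · exact fun x hx => Or.inr (Or.inl (iha h hx))
    · exact fun x hx => Or.inr (Or.inr (ihb h hx))

end ACTL

/-! ### Fullpaths, preservation of untils along transitions, destuttering -/

namespace LPath

variable {State : Type u} {Label : Type v}

/-- The sequence `π` preceded by a transition labelled `l` from `s`. -/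
def cons (s : State) (l : Label) (π : LPath State Label) : LPath State Label where
  len := π.len + 1
  st n := Nat.casesOn n s π.st
  lab n := Nat.casesOn n l π.lab

end LPath

namespace Kripke

variable {State : Type u} {Atom : Type v} {Label : Type w} {M : Kripke State Atom Label}

theorem IsFullpathFrom.cons {s t : State} {l : Label} {π : LPath State Label}
    (h : M.IsFullpathFrom t π) (hR : M.R s l t) : M.IsFullpathFrom s (π.cons s l) := by
  obtain ⟨h0, hstep, hmax⟩ := h
  refine ⟨rfl, ?_, ?_⟩
  · rintro (_ | n) hn
    · simpa [LPath.cons, h0] using hR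
    · refine hstep n ?_
      have : ((n : ℕ∞) + 1) < π.len + 1 := by simpa [LPath.cons] using hn
      exact lt_of_add_lt_add_right this
  · rintro (_ | n) hn
    · simp [LPath.cons] at hn
    · refine hmax n ?_
      have : π.len + 1 = (n : ℕ∞) + 1 := by simpa [LPath.cons] using hn
      exact WithTop.add_right_cancel ENat.one_ne_top this

theorem exists_isFullpathFrom [Nonempty Label] (M : Kripke State Atom Label) (s : State) :
    ∃ π, M.IsFullpathFrom s π := by
  classical
  -- At a dead end the chosen value is a dummy; the path built below ends at the first dead end, so
  -- no dummy transition belongs to it.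
  have hnext : ∀ a : State, ∃ p : Label × State, (∃ l t, M.R a l t) → M.R a p.1 p.2 := by
    intro a
    by_cases h : ∃ l t, M.R a l t
    · obtain ⟨l, t, h⟩ := h
      exact ⟨(l, t), fun _ => h⟩
    · exact ⟨(Classical.arbitrary Label, a), fun h' => absurd h' h⟩
  choose next hnext using hnext
  let st : ℕ → State := fun n => (fun a => (next a).2)^[n] s
  have st_succ : ∀ n, st (n + 1) = (next (st n)).2 := fun n =>
    Function.iterate_succ_apply' _ _ _
  by_cases h : ∃ n, ¬ ∃ l t, M.R (st n) l t
  · refine ⟨⟨(Nat.find h : ℕ), st, fun n => (next (st n)).1⟩, rfl, ?_, ?_⟩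
    · intro n hn
      have := Nat.find_min h (Nat.cast_lt.1 hn)
      rw [not_not] at this
      simpa only [st_succ] using hnext _ this
    · intro n hn l t hR
      obtain rfl : Nat.find h = n := Nat.cast_injective hn
      exact Nat.find_spec h ⟨l, t, hR⟩
  · push Not at h
    refine ⟨⟨⊤, st, fun n => (next (st n)).1⟩, rfl, ?_, ?_⟩
    · intro n _
      simpa only [st_succ] using hnext _ (h n)
    · intro n hn
      exact absurd hn (ENat.top_ne_natCast n)

theorem AG.step {φ : State → Prop} {s t : State} {l : Label} (h : M.AG φ s) (hR : M.R s l t) :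
    M.AG φ t := by
  intro π hπ n hn
  have := h _ (hπ.cons hR) (n + 1) (by simpa [LPath.cons] using add_le_add_left hn 1)
  simpa [LPath.cons] using this

/-- `AG` speaks of fullpaths only. Prefixing transitions moves it forward to the reached state, and
there at least one fullpath exists. -/
theorem AG.of_reaches [Nonempty Label] {φ : State → Prop} {s t : State} (h : M.AG φ s)
    (hst : M.Reaches s t) : φ t := by
  induction hst using Relation.ReflTransGen.head_induction_on with
  | refl =>
    obtain ⟨π, hπ⟩ := M.exists_isFullpathFrom t
    simpa [hπ.1] using h π hπ 0 (by simp)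
  | head hR _ ih =>
    obtain ⟨l, hR⟩ := hR
    exact ih (h.step hR)

theorem EF.of_reaches [Nonempty Label] {φ : State → Prop} {s t : State}
    (hst : M.Reaches s t) (ht : φ t) : M.EF φ s := by
  by_contra hcon
  have h : M.AG (fun r => ¬ φ r) s := by
    intro π hπ n hn hφ
    exact hcon ⟨π, hπ, n, hn, hφ⟩
  exact h.of_reaches hst ht

/-- A fullpath from the successor, prefixed by the transition, is a fullpath from the original
state; since g fails at its first position, all requirements shift by one. -/
theorem Sat.AW_step {f g : ACTL Atom} {s t : State} {l : Label} (h : M.Sat (.AW f g) s)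
    (hg : ¬ M.Sat g s) (hR : M.R s l t) : M.Sat (.AW f g) t := by
  intro π hπ _ n hn hng
  have := h _ (hπ.cons hR) trivial (n + 1)
    (by simpa [LPath.cons] using add_le_add_left hn 1) ?_
  · simpa [LPath.cons] using this
  · rintro (_ | m) hm
    · exact hg
    · exact hng m (by omega)

/-- Not vacuous because some fullpath starts in every state. -/
theorem Sat.AW_now [Nonempty Label] {f g : ACTL Atom} {s : State} (h : M.Sat (.AW f g) s)
    (hg : ¬ M.Sat g s) : M.Sat f s := by
  obtain ⟨π, hπ⟩ := M.exists_isFullpathFrom s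
  have := h π hπ trivial 0 (by simp) ?_
  · simpa [hπ.1, Sat] using this
  · intro m hm
    obtain rfl : m = 0 := by omega
    rw [hπ.1]
    exact hg

theorem Sat.AU_step {f g : ACTL Atom} {s t : State} {l : Label} (h : M.Sat (.AU f g) s)
    (hg : ¬ M.Sat g s) (hR : M.R s l t) : M.Sat (.AU f g) t := by
  intro π hπ _
  obtain ⟨n, hn, hgn, hf⟩ := h _ (hπ.cons hR) trivial
  rcases n with _ | n
  · exact absurd hgn hg
  · refine ⟨n, ?_, hgn, fun m hm => hf (m + 1) (by omega)⟩
    have : (n : ℕ∞) + 1 ≤ π.len + 1 := by simpa [LPath.cons] using hn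
    exact (ENat.add_le_add_iff_right ENat.one_ne_top).1 this

theorem Sat.AU_now [Nonempty Label] {f g : ACTL Atom} {s : State} (h : M.Sat (.AU f g) s)
    (hg : ¬ M.Sat g s) : M.Sat f s := by
  obtain ⟨π, hπ⟩ := M.exists_isFullpathFrom s
  obtain ⟨n, -, hgn, hf⟩ := h π hπ trivial
  rcases n with _ | n
  · rw [hπ.1] at hgn
    exact absurd hgn hg
  · simpa [hπ.1, Sat] using hf 0 (by omega)

theorem Sat.AF_of_AU {f g : ACTL Atom} {s : State} (h : M.Sat (.AU f g) s) : M.Sat g.AF s := by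
  intro π hπ _
  obtain ⟨n, hn, hgn, -⟩ := h π hπ trivial
  exact ⟨n, hn, hgn, fun _ _ => trivial⟩

/-- Removing the stuttering steps from an infinite sequence of states that has infinitely many
proper transitions yields an infinite fullpath. The states of the sequence are states of the
fullpath, in the same order. -/
theorem exists_destuttered (x : ℕ → State) (lab : ℕ → Label) (p : ℕ → Prop)
    (hinf : ∀ n, ∃ m, n ≤ m ∧ p m) (hp : ∀ n, p n → M.R (x n) (lab n) (x (n + 1)))
    (hnp : ∀ n, ¬ p n → x (n + 1) = x n) :
    ∃ (π : LPath State Label) (c : ℕ → ℕ), M.IsFullpathFrom (x 0) π ∧ π.len = ⊤ ∧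
      (∀ m, ∃ n, p n ∧ π.lab m = lab n ∧ π.st m = x n) ∧
      (∀ n, x n = π.st (c n)) ∧ ∀ k, ∃ n, ∀ m, n ≤ m → k ≤ c m := by
  classical
  have hfin : (Set.ofPred p).Infinite := by
    refine Set.infinite_of_not_bddAbove ?_
    rintro ⟨b, hb⟩
    obtain ⟨m, hm, hpm⟩ := hinf (b + 1)
    have : m ≤ b := hb hpm
    omega
  -- Between a position and the next proper transition there is only stuttering, so the state there
  -- is the one from which that transition departs.
  have hconst : ∀ n, x n = x (Nat.nth p (Nat.count p n)) := by
    intro n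
    have key : ∀ m, n ≤ m → m ≤ Nat.nth p (Nat.count p n) → x m = x n := by
      intro m hm
      induction m, hm using Nat.le_induction with
      | base => exact fun _ => rfl
      | succ m hm ih =>
        intro hlt
        rw [hnp m, ih (by omega)]
        intro hpm
        have h1 : Nat.count p (m + 1) = Nat.count p m + 1 := by
          rw [Nat.count_succ, if_pos hpm]
        have h2 : Nat.count p n ≤ Nat.count p m := Nat.count_monotone p hm
        have h3 : Nat.nth p (Nat.count p n) < m + 1 := Nat.nth_lt_of_lt_count (by omega)
        omega
    exact (key _ (Nat.le_nth_count hfin n) le_rfl).symm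
  have hmem : ∀ n, p (Nat.nth p n) := Nat.nth_mem_of_infinite hfin
  -- The r-th state is the source of the r-th proper transition; position n of the sequence
  -- corresponds to the number of proper transitions before n.
  refine ⟨⟨⊤, fun n => x (Nat.nth p n), fun n => lab (Nat.nth p n)⟩, Nat.count p,
    ⟨?_, ?_, ?_⟩, rfl, fun m => ⟨_, hmem m, rfl, rfl⟩, hconst, ?_⟩
  · simpa using (hconst 0).symm
  · intro n _
    have h := hconst (Nat.nth p n + 1)
    rw [Nat.count_succ, if_pos (hmem n), Nat.count_nth_of_infinite hfin] at h
    have := hp _ (hmem n)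
    rw [h] at this
    exact this
  · intro n hn
    exact absurd hn (ENat.top_ne_natCast n)
  · intro k
    refine ⟨Nat.nth p k, fun m hm => ?_⟩
    have := Nat.count_monotone p hm
    rwa [Nat.count_nth_of_infinite hfin] at this

end Kripke
end DynProg

/-! ### Configurations and their wait-for-graphs -/

namespace DynProg

variable {Sg : Signature.{u, v, w, x}} {D : DynamicSpec Sg} {syn : SynthesisMethod Sg}

theorem not_isDiag_of_mem_pairsOf {I : Set (PairSpec Sg)} {e : Sym2 Sg.Pid} (he : e ∈ pairsOf I) :
    ¬ e.IsDiag := by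
  obtain ⟨σ, -, rfl⟩ := he
  exact σ.not_diag

namespace Config

/-- The effect of a transition of the synthesized program on one active pair-program. -/
theorem Step.pair {s t : Config D} {l : Option Sg.Pid} (h : s.Step syn l t) {e : Sym2 Sg.Pid}
    (hs : e ∈ s.pairs) : ∃ ht : e ∈ t.pairs, t.prog e ht = s.prog e hs ∧
      ((∃ i ∈ e, l = some i ∧ (s.prog e hs).toKripke.R (s.state e hs) i (t.state e ht)) ∨
        ((∀ i ∈ e, l ≠ some i) ∧ t.state e ht = s.state e hs)) := by
  rcases l with _ | i
  · obtain ⟨σ, -, -, hI, -, hold⟩ := h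
    have ht : e ∈ t.pairs := by
      obtain ⟨τ, hτ, rfl⟩ := hs
      exact ⟨τ, hI ▸ Or.inl hτ, rfl⟩
    obtain ⟨h1, h2⟩ := hold e hs ht
    exact ⟨ht, h1, Or.inr ⟨by simp, h2⟩⟩
  · obtain ⟨-, hI, hold⟩ := h
    have ht : e ∈ t.pairs := by
      show e ∈ pairsOf t.inForce
      rw [hI]
      exact hs
    obtain ⟨h1, h2, h3, h4⟩ := hold e hs ht
    refine ⟨ht, h1, ?_⟩
    by_cases hi : i ∈ e
    · refine Or.inl ⟨i, hi, rfl, s.isState e hs, h1 ▸ t.isState e ht, hi, h2 hi, ?_⟩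
      rintro ⟨k, hk⟩ hki
      exact h3 k hk hki
    · refine Or.inr ⟨?_, h4 hi⟩
      rintro k hk h
      obtain rfl : i = k := Option.some.inj h
      exact hi hk

theorem Step.inForce_subset {s t : Config D} {l : Option Sg.Pid} (h : s.Step syn l t) :
    s.inForce ⊆ t.inForce := by
  rcases l with _ | i
  · obtain ⟨σ, -, -, hI, -⟩ := h
    rw [hI]
    exact Set.subset_union_left
  · exact h.2.1.ge

/-- The pair-states of a reachable configuration are reachable in the active pair-programs. -/
theorem Reachable.pair {s : Config D} (h : s.Reachable syn) {e : Sym2 Sg.Pid}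
    (he : e ∈ s.pairs) : (s.prog e he).Reachable (s.state e he) := by
  induction h with
  | init h => exact ⟨_, h.2.2 e he, Relation.ReflTransGen.refl⟩
  | @step s t l _ hst ih =>
    by_cases hs : e ∈ s.pairs
    · obtain ⟨_, hprog, hstate⟩ := hst.pair hs
      rw [hprog]
      rcases hstate with ⟨i, -, -, hR⟩ | ⟨-, heq⟩
      · obtain ⟨s₀, h₀, hr⟩ := ih hs
        exact ⟨s₀, h₀, hr.tail ⟨i, hR⟩⟩
      · rw [heq]
        exact ih hs
    · rcases l with _ | i
      · obtain ⟨σ, -, -, hI, ⟨_, -, -, hr, -⟩, -⟩ := hst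
        obtain ⟨τ, hτ, rfl⟩ := he
        rw [hI] at hτ
        rcases hτ with hτ | hτ
        · exact absurd ⟨τ, hτ, rfl⟩ hs
        · obtain rfl : τ = σ := hτ
          exact hr
      · refine absurd ?_ hs
        show e ∈ pairsOf s.inForce
        rw [← hst.2.1]
        exact he

/-- One pair suffices to test an arc, because all pairs agree on the local state and on the
unlabelled skeleton of a common process. -/
theorem hasArc_iff (s : Config D) {e : Sym2 Sg.Pid} (he : e ∈ s.pairs) {i : Sg.Pid} (hi : i ∈ e)
    (a b : Sg.LocalState i) : s.HasArc i a b ↔ (s.state e he).loc ⟨i, hi⟩ = a ∧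
      ∃ L, ((s.prog e he).skel ⟨i, hi⟩).label a b = some L := by
  constructor
  · exact fun h => h.2 e he hi
  · rintro ⟨ha, hL⟩
    refine ⟨⟨e, he, hi⟩, fun e' he' hi' => ⟨?_, ?_⟩⟩
    · rw [← ha]
      exact s.consistent e' he' e he i hi' hi
    · have h := congrArg (fun g => g.2 a b) (s.same_graph e' he' e he i hi' hi)
      exact (iff_of_eq h).2 hL

theorem wEdge_proc_iff (s : Config D) (i : Sg.Pid) (n : WFNode Sg) :
    s.WEdge (.proc i) n ↔ ∃ a b, n = .arc i a b ∧ s.HasArc i a b := by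
  constructor
  · rcases n with j | ⟨k, a, b⟩
    · exact False.elim
    · rintro ⟨rfl, h⟩
      exact ⟨a, b, rfl, h⟩
  · rintro ⟨a, b, rfl, h⟩
    exact ⟨rfl, h⟩

theorem wEdge_arc_iff (s : Config D) (i : Sg.Pid) (a b : Sg.LocalState i) (n : WFNode Sg) :
    s.WEdge (.arc i a b) n ↔ ∃ j, n = .proc j ∧ s.HasArc i a b ∧ s.Blocked i a b j := by
  constructor
  · rcases n with j | ⟨k, a, b⟩
    · exact fun h => ⟨j, rfl, h⟩
    · exact False.elim
  · rintro ⟨j, rfl, h⟩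
    exact h

/-- An arc without outgoing edges in the wait-for-graph is enabled. -/
theorem enabled_of_not_wEdge {s : Config D} {i : Sg.Pid} {a b : Sg.LocalState i}
    (h : s.HasArc i a b) (hno : ∀ j, ¬ s.WEdge (.arc i a b) (.proc j)) : s.Enabled i := by
  refine ⟨a, b, h, fun e he hi L hL => ?_⟩
  obtain ⟨j, rfl⟩ := hi
  by_contra hg
  exact hno j ⟨h, he, L, hL, hg⟩

/-- A process at which an edge of the wait-for-graph of a reachable configuration ends is in a
sometimes-blocking local state. -/
theorem Reachable.blk {s : Config D} (hs : s.Reachable syn) {i j : Sg.Pid}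
    {a b : Sg.LocalState i} (h : s.WEdge (.arc i a b) (.proc j)) : s.Blk j := by
  obtain ⟨harc, he, L, hL, hg⟩ := h
  have : Nonempty Sg.Pid := ⟨i⟩
  obtain ⟨s₀, h₀, hr⟩ := hs.pair he
  refine ⟨s(i, j), he, Sym2.mem_mk_right i j, s₀, h₀, .of_reaches hr ⟨rfl, ?_⟩⟩
  refine ⟨⟨i, Sym2.mem_mk_left i j⟩, ?_, b, L, ?_, hg⟩
  · intro hij
    exact not_isDiag_of_mem_pairsOf he (congrArg Subtype.val hij)
  · rw [(harc.2 _ he (Sym2.mem_mk_left i j)).1]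
    exact hL

/-- If the wait-for-graph has no supercycle, then from each pair an arc without outgoing edges can
be reached. -/
theorem SupercycleFree.exists_arc {s : Config D} (h : s.SupercycleFree) {e : Sym2 Sg.Pid}
    (he : e ∈ s.pairs) : ∃ i ∈ e, ∃ k a b,
      Relation.ReflTransGen s.WEdge (.proc i) (.arc k a b) ∧
      ∀ j, ¬ s.WEdge (.arc k a b) (.proc j) := by
  by_contra! hcon
  -- Everything reachable from the pair, with all its edges, would be a supercycle if each reachable
  -- arc had an outgoing edge.
  let V : Set (WFNode Sg) := {n | ∃ i ∈ e, Relation.ReflTransGen s.WEdge (.proc i) n}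
  have hV : ∀ m ∈ V, ∀ n, s.WEdge m n → n ∈ V := by
    rintro m ⟨i, hi, hm⟩ n hmn
    exact ⟨i, hi, hm.tail hmn⟩
  refine h ⟨V, fun m n => m ∈ V ∧ s.WEdge m n, ?_, ?_, ?_, ?_, ?_⟩
  · rintro n ⟨i, hi, hn⟩
    rcases Relation.ReflTransGen.cases_tail hn with rfl | ⟨m, -, hmn⟩
    · exact ⟨e, he, hi⟩
    · rcases m with m | ⟨k, a, b⟩
      · obtain ⟨a, b, rfl, h⟩ := (s.wEdge_proc_iff _ _).1 hmn
        exact h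
      · obtain ⟨j, rfl, -, he', -⟩ := (s.wEdge_arc_iff _ _ _ _).1 hmn
        exact ⟨_, he', Sym2.mem_mk_right _ _⟩
  · rintro m n ⟨hm, hmn⟩
    exact ⟨hm, hV m hm n hmn, hmn⟩
  · induction e with | _ i j =>
    exact ⟨.proc i, i, Sym2.mem_mk_left i j, .refl⟩
  · exact fun i hi a b hab => ⟨hi, rfl, hab⟩
  · rintro i a b ⟨k, hk, hp⟩
    obtain ⟨j, hj⟩ := hcon k hk i a b hp
    exact ⟨j, hj, ⟨k, hk, hp⟩, hj⟩

end Config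

/-! ### Infinite runs and their projections onto a pair -/

/-- At the last position of a finite path no further transition is taken. -/
theorem CreationFair.len_eq_top {π : LPath (Config D) (Option Sg.Pid)} (h : CreationFair π) :
    π.len = ⊤ := by
  by_contra hne
  obtain ⟨n, hn⟩ := ENat.ne_top_iff_exists.1 hne
  obtain ⟨m, hm, -, i, hlt, -⟩ := h n hn.le
  rw [← hn] at hlt
  exact absurd (Nat.cast_lt.1 hlt) (by omega)

/-- The sequences of configurations and labels along infinite paths of `M_P`. -/
structure IsRun (syn : SynthesisMethod Sg) (x : ℕ → Config D) (lab : ℕ → Option Sg.Pid) :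
    Prop where
  reachable : ∀ n, (x n).Reachable syn
  step : ∀ n, (x n).Step syn (lab n) (x (n + 1))

namespace IsRun

variable {x : ℕ → Config D} {lab : ℕ → Option Sg.Pid}

theorem inForce_mono (h : IsRun syn x lab) {m n : ℕ} (hmn : m ≤ n) :
    (x m).inForce ⊆ (x n).inForce := by
  induction n, hmn using Nat.le_induction with
  | base => exact subset_rfl
  | succ n _ ih => exact ih.trans (h.step n).inForce_subset

theorem pairs_mono (h : IsRun syn x lab) {m n : ℕ} (hmn : m ≤ n) :
    (x m).pairs ⊆ (x n).pairs := by
  rintro e ⟨σ, hσ, he⟩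
  exact ⟨σ, h.inForce_mono hmn hσ, he⟩

theorem prog_eq (h : IsRun syn x lab) {m n : ℕ} (hmn : m ≤ n) {e : Sym2 Sg.Pid}
    (he : e ∈ (x m).pairs) (he' : e ∈ (x n).pairs) : (x n).prog e he' = (x m).prog e he := by
  induction n, hmn using Nat.le_induction with
  | base => rfl
  | succ n hmn ih =>
    obtain ⟨_, hp, -⟩ := (h.step n).pair (h.pairs_mono hmn he)
    rw [hp, ih]

/-- The effect of a transition on a pair-program that is active from position `m` onwards. -/
theorem pair_step (h : IsRun syn x lab) {m n : ℕ} (hmn : m ≤ n) {e : Sym2 Sg.Pid}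
    (he : e ∈ (x m).pairs) (hn : e ∈ (x n).pairs) (hn' : e ∈ (x (n + 1)).pairs) :
    (∃ i ∈ e, lab n = some i ∧
        ((x m).prog e he).toKripke.R ((x n).state e hn) i ((x (n + 1)).state e hn')) ∨
      ((∀ i ∈ e, lab n ≠ some i) ∧ (x (n + 1)).state e hn' = (x n).state e hn) := by
  obtain ⟨_, -, hs⟩ := (h.step n).pair hn
  rwa [h.prog_eq hmn he hn] at hs

/-- A process that executes no transition from position `m` onwards does not change its local
state. -/
theorem loc_eq (h : IsRun syn x lab) {m n : ℕ} (hmn : m ≤ n) {e : Sym2 Sg.Pid} {i : Sg.Pid}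
    (hi : i ∈ e) (hfr : ∀ k, m ≤ k → lab k ≠ some i)
    (he : e ∈ (x m).pairs) (he' : e ∈ (x n).pairs) :
    ((x n).state e he').loc ⟨i, hi⟩ = ((x m).state e he).loc ⟨i, hi⟩ := by
  induction n, hmn using Nat.le_induction with
  | base => rfl
  | succ n hmn ih =>
    have hn := h.pairs_mono hmn he
    rw [← ih hn]
    rcases h.pair_step hmn he hn he' with ⟨j, -, hlab, -, -, -, -, hoth⟩ | ⟨-, heq⟩
    · refine hoth ⟨i, hi⟩ ?_
      rintro rfl
      exact hfr n hmn hlab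
    · rw [heq]

/-- If the processes of a pair execute no transition from position `m` onwards, then the pair-state
does not change. -/
theorem state_eq (h : IsRun syn x lab) {m n : ℕ} (hmn : m ≤ n) {e : Sym2 Sg.Pid}
    (hfr : ∀ i ∈ e, ∀ k, m ≤ k → lab k ≠ some i)
    (he : e ∈ (x m).pairs) (he' : e ∈ (x n).pairs) :
    (x n).state e he' = (x m).state e he := by
  induction n, hmn using Nat.le_induction with
  | base => rfl
  | succ n hmn ih =>
    have hn := h.pairs_mono hmn he
    rw [← ih hn]
    rcases h.pair_step hmn he hn he' with ⟨j, hj, hlab, -⟩ | ⟨-, heq⟩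
    · exact absurd hlab (hfr j hj n hmn)
    · exact heq

/-- The projection of a run onto a pair whose processes execute infinitely often, without the
stuttering steps, is an infinite fullpath of the pair-structure. -/
theorem exists_projection (h : IsRun syn x lab) {m : ℕ} {e : Sym2 Sg.Pid}
    (he : e ∈ (x m).pairs) (hinf : ∀ n, ∃ k, n ≤ k ∧ ∃ i ∈ e, lab k = some i) :
    ∃ (π : LPath (PairState Sg e) Sg.Pid) (c : ℕ → ℕ),
      ((x m).prog e he).toKripke.IsFullpathFrom ((x m).state e he) π ∧ π.len = ⊤ ∧
      (∀ r, ∃ n, m ≤ n ∧ lab n = some (π.lab r) ∧ ∃ hn, π.st r = (x n).state e hn) ∧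
      (∀ n, m ≤ n → ∀ hn, (x n).state e hn = π.st (c n)) ∧ ∀ k, ∃ n, ∀ m, n ≤ m → k ≤ c m := by
  have hmem : ∀ n, e ∈ (x (m + n)).pairs := fun n => h.pairs_mono (by omega) he
  have hpid : Nonempty Sg.Pid := by
    obtain ⟨-, -, i, -⟩ := hinf 0
    exact ⟨i⟩
  obtain ⟨π, c, hπ, hlen, hst, hc, hc'⟩ :=
    Kripke.exists_destuttered (M := ((x m).prog e he).toKripke)
      (fun n => (x (m + n)).state e (hmem n))
      -- The default label occurs only at create transitions, which are stuttering steps for the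
      -- pair.
      (fun n => (lab (m + n)).getD (Classical.arbitrary _))
      (fun n => ∃ i ∈ e, lab (m + n) = some i)
      (by
        intro n
        obtain ⟨k, hk, hik⟩ := hinf (m + n)
        obtain ⟨d, rfl⟩ := Nat.exists_eq_add_of_le (show m ≤ k by omega)
        exact ⟨d, by omega, hik⟩)
      (by
        rintro n ⟨i, hi, hlab⟩
        rcases h.pair_step (by omega) he (hmem n) (hmem (n + 1)) with
          ⟨j, -, hj, hR⟩ | ⟨hno, -⟩
        · rw [hj]
          exact hR
        · exact absurd hlab (hno i hi))
      (by
        intro n hn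
        rcases h.pair_step (by omega) he (hmem n) (hmem (n + 1)) with
          ⟨j, hj, hlab, -⟩ | ⟨-, heq⟩
        · exact absurd ⟨j, hj, hlab⟩ hn
        · exact heq)
  -- The run was shifted by `m`; the truncated subtraction is harmless since only positions from `m`
  -- on matter.
  refine ⟨π, fun n => c (n - m), hπ, hlen, ?_, ?_, ?_⟩
  · intro r
    obtain ⟨n, ⟨i, -, hi⟩, hl, hs⟩ := hst r
    refine ⟨m + n, by omega, ?_, hmem n, hs⟩
    rw [hl, hi]
    rfl
  · intro n hn hn'
    obtain ⟨d, rfl⟩ := Nat.exists_eq_add_of_le hn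
    simpa using hc d
  · intro k
    obtain ⟨n, hn⟩ := hc' k
    exact ⟨m + n, fun r hr => hn _ (by omega)⟩

end IsRun
end DynProg

/-! ### Wait-for-graphs along a run -/

namespace DynProg

open Filter

variable {Sg : Signature.{u, v, w, x}} {D : DynamicSpec Sg} {syn : SynthesisMethod Sg}

namespace IsRun

variable {x : ℕ → Config D} {lab : ℕ → Option Sg.Pid}

/-- The arcs in the wait-for-graph of a process that executes finitely often do not change from
some position onwards. -/
theorem eventually_hasArc_iff (h : IsRun syn x lab) {i : Sg.Pid}
    (hi : ∀ᶠ n in atTop, lab n ≠ some i) :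
    ∀ᶠ m in atTop, ∀ n, m ≤ n → ∀ a b, (x n).HasArc i a b ↔ (x m).HasArc i a b := by
  obtain ⟨r, hr⟩ := eventually_atTop.1 hi
  by_cases hp : ∃ m e, e ∈ (x m).pairs ∧ i ∈ e
  · obtain ⟨q, e, heq, hie⟩ := hp
    filter_upwards [eventually_ge_atTop (max q r)] with m hm n hmn a b
    have hem := h.pairs_mono ((le_max_left q r).trans hm) heq
    have hen := h.pairs_mono hmn hem
    rw [(x n).hasArc_iff hen hie, (x m).hasArc_iff hem hie, h.prog_eq hmn hem hen,
      h.loc_eq hmn hie (fun k hk => hr k (((le_max_right q r).trans hm).trans hk)) hem hen]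
  -- A process that never occurs in a pair has no arcs at any position.
  · refine Eventually.of_forall fun m n _ a b => ⟨fun hab => ?_, fun hab => ?_⟩
    · obtain ⟨e, he, hie⟩ := hab.1
      exact absurd ⟨n, e, he, hie⟩ hp
    · obtain ⟨e, he, hie⟩ := hab.1
      exact absurd ⟨m, e, he, hie⟩ hp

/-- The edges in the wait-for-graph from arcs of a process that executes finitely often to a
process that executes finitely often do not change from some position onwards. -/
theorem eventually_wEdge_iff (h : IsRun syn x lab) {i j : Sg.Pid}
    (hi : ∀ᶠ n in atTop, lab n ≠ some i) (hj : ∀ᶠ n in atTop, lab n ≠ some j) :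
    ∀ᶠ m in atTop, ∀ n, m ≤ n → ∀ a b,
      (x n).WEdge (.arc i a b) (.proc j) ↔ (x m).WEdge (.arc i a b) (.proc j) := by
  obtain ⟨r, hr⟩ := eventually_atTop.1 (hi.and hj)
  by_cases hp : ∃ m, s(i, j) ∈ (x m).pairs
  · obtain ⟨q, heq⟩ := hp
    filter_upwards [eventually_ge_atTop (max q r), h.eventually_hasArc_iff hi] with m hm harc
      n hmn a b
    have hem := h.pairs_mono ((le_max_left q r).trans hm) heq
    have hen := h.pairs_mono hmn hem
    have hst : (x n).state s(i, j) hen = (x m).state s(i, j) hem := by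
      refine h.state_eq hmn (fun k hk d hd => ?_) hem hen
      have := hr d (((le_max_right q r).trans hm).trans hd)
      rcases Sym2.mem_iff.1 hk with rfl | rfl
      · exact this.1
      · exact this.2
    refine and_congr (harc n hmn a b) ?_
    simp only [Config.Blocked, hem, hen, exists_true_left, hst, h.prog_eq hmn hem hen]
  · refine Eventually.of_forall fun m n _ a b => ⟨fun hab => ?_, fun hab => ?_⟩
    · exact absurd ⟨n, hab.2.1⟩ hp
    · exact absurd ⟨m, hab.2.1⟩ hp

/-- From some position onwards, a process that executes finitely often does not wait for a process
that executes infinitely often. -/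
theorem eventually_not_wEdge (h : IsRun syn x lab) (liveness : LivenessCondition D syn)
    {i j : Sg.Pid} (hi : ∀ᶠ n in atTop, lab n ≠ some i) (hj : ∃ᶠ n in atTop, lab n = some j) :
    ∀ᶠ n in atTop, ∀ a b, ¬ (x n).WEdge (.arc i a b) (.proc j) := by
  by_cases hp : ∃ m, s(i, j) ∈ (x m).pairs
  swap
  · exact Eventually.of_forall fun n a b hab => hp ⟨n, hab.2.1⟩
  obtain ⟨q, heq⟩ := hp
  obtain ⟨r, hr⟩ := eventually_atTop.1 hi
  -- From here on the pair is active and i no longer moves, so every transition of the projection is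
  -- by j. Part (a) of the liveness condition, with the roles of i and j exchanged, then eventually
  -- enables all arcs of i with respect to j.
  let m := max q r
  have he : s(i, j) ∈ (x m).pairs := h.pairs_mono (le_max_left q r) heq
  have hne : i ≠ j := fun hij => not_isDiag_of_mem_pairsOf he hij
  have : Nonempty Sg.Pid := ⟨i⟩
  have hj' := frequently_atTop.1 hj
  obtain ⟨π, c, hπ, hlen, hlab, hst, hc⟩ := h.exists_projection he fun n => by
    obtain ⟨k, hk, hl⟩ := hj' n
    exact ⟨k, hk, j, Sym2.mem_mk_right i j, hl⟩
  obtain ⟨s₀, h₀, hreach⟩ := (h.reachable m).pair he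
  have hlive := (liveness.1 (x m) (h.reachable m) s(i, j) he ⟨j, Sym2.mem_mk_right i j⟩
    ⟨i, Sym2.mem_mk_left i j⟩ (fun hji => hne (congrArg Subtype.val hji).symm) s₀ h₀).of_reaches
    hreach π hπ ?_
  · obtain ⟨k, -, hk⟩ := hlive
    obtain ⟨d, hd⟩ := hc k
    filter_upwards [eventually_ge_atTop (max m d)] with n hn a b hab
    have hmn : m ≤ n := (le_max_left m d).trans hn
    have hen := h.pairs_mono hmn he
    obtain ⟨harc, _, L, hL, hg⟩ := hab
    refine hg ?_
    have hall := hk (c n) (hd n ((le_max_right m d).trans hn)) (by simp [hlen])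
    beta_reduce at hall
    rw [← hst n hmn hen] at hall
    refine hall b L ?_
    rw [(harc.2 _ hen (Sym2.mem_mk_left i j)).1, ← h.prog_eq hmn he hen]
    exact hL
  · intro n _
    refine ⟨by simp [hlen], ?_⟩
    obtain ⟨-, -, hmem, -⟩ := hπ.2.1 n (by simp [hlen])
    rcases Sym2.mem_iff.1 hmem with hi' | hj'
    · obtain ⟨k, hk, hl, -⟩ := hlab n
      rw [hi'] at hl
      exact absurd hl (hr k ((le_max_right q r).trans hk))
    · exact hj'

/-- While an eventuality of a pair is pending, one of its processes executes infinitely often,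
provided that the run is fair. -/
theorem frequently_ex (h : IsRun syn x lab) (liveness : LivenessCondition D syn)
    (supercycle_free : ∀ r : Config D, r.Reachable syn → r.SupercycleFree)
    {e : Sym2 Sg.Pid} (hpnd : ∀ n, (x n).Pnd e)
    (hblk : ∀ k, (∀ᶠ n in atTop, (x n).Blk k ∧ (x n).Enabled k) → ∃ᶠ n in atTop, lab n = some k)
    (hev : ∀ i ∈ e, (∀ᶠ n in atTop, (x n).Enabled i) →
      ∃ᶠ n in atTop, ∃ j ∈ e, lab n = some j) :
    ∃ᶠ n in atTop, ∃ i ∈ e, lab n = some i := by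
  by_contra hcon
  rw [not_frequently] at hcon
  have hmem : ∀ n, e ∈ (x n).pairs := fun n => (hpnd n).1
  obtain ⟨W, hW, hWsub⟩ := liveness.2 (x 0) (h.reachable 0) e (hmem 0) (hpnd 0)
  have hblockers : ∀ n, (x n).blockers e ⊆ W := by
    intro n
    refine hWsub _ ?_
    induction n with
    | zero => exact .refl
    | succ n ih =>
      exact ih.tail ⟨hpnd n, hpnd (n + 1), lab n, h.reachable n, h.reachable (n + 1), h.step n⟩
  -- Finiteness of `A` and `W` is what allows one common threshold in the `eventually` statements
  -- below.
  let A : Set Sg.Pid := {k | (k ∈ W ∨ k ∈ e) ∧ ∀ᶠ n in atTop, lab n ≠ some k}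
  have heA : ∀ i ∈ e, i ∈ A := fun i hi => ⟨Or.inr hi, hcon.mono fun n hn hl => hn ⟨i, hi, hl⟩⟩
  have hefin : {k | k ∈ e}.Finite := by
    induction e with | _ i j =>
    exact (Set.toFinite {i, j}).subset fun k hk => by simpa using hk
  have hAfin : A.Finite := (hW.union hefin).subset fun k hk => hk.1
  have harc : ∀ᶠ m in atTop, ∀ k ∈ A, ∀ n, m ≤ n → ∀ a b,
      (x n).HasArc k a b ↔ (x m).HasArc k a b :=
    (eventually_all_finite hAfin).2 fun k hk => h.eventually_hasArc_iff hk.2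
  have hedge : ∀ᶠ m in atTop, ∀ k ∈ A, ∀ l ∈ A, ∀ n, m ≤ n → ∀ a b,
      (x n).WEdge (.arc k a b) (.proc l) ↔ (x m).WEdge (.arc k a b) (.proc l) :=
    (eventually_all_finite hAfin).2 fun k hk =>
      (eventually_all_finite hAfin).2 fun l hl => h.eventually_wEdge_iff hk.2 hl.2
  have hnoedge : ∀ᶠ m in atTop, ∀ k ∈ A, ∀ l ∈ W, l ∉ A → ∀ a b,
      ¬ (x m).WEdge (.arc k a b) (.proc l) := by
    refine (eventually_all_finite hAfin).2 fun k hk => (eventually_all_finite hW).2 fun l hl => ?_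
    by_cases hlA : l ∈ A
    · exact Eventually.of_forall fun m hm => absurd hlA hm
    · refine (h.eventually_not_wEdge liveness hk.2 ?_).mono fun m hm _ => hm
      by_contra hfr
      exact hlA ⟨Or.inl hl, not_frequently.1 hfr⟩
  obtain ⟨m, hm⟩ := eventually_atTop.1 (harc.and (hedge.and hnoedge))
  have harc' : ∀ n, m ≤ n → ∀ n', m ≤ n' → ∀ k ∈ A, ∀ a b,
      (x n).HasArc k a b → (x n').HasArc k a b := fun n hn n' hn' k hk a b hab =>
    ((hm m le_rfl).1 k hk n' hn' a b).2 (((hm m le_rfl).1 k hk n hn a b).1 hab)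
  -- The target of an edge reachable from the pair lies in `W` by part (b), hence in `A` since
  -- waiting for the rest of `W` has ceased; edges inside `A` are frozen.
  have hblocked : ∀ n, m ≤ n → ∀ i ∈ e, ∀ k ∈ A, ∀ a b l,
      Relation.ReflTransGen (x n).WEdge (.proc i) (.arc k a b) →
      (x n).WEdge (.arc k a b) (.proc l) →
      l ∈ A ∧ ∀ n', m ≤ n' → (x n').WEdge (.arc k a b) (.proc l) := by
    intro n hn i hi k hk a b l hp hl
    have hlW : l ∈ W := hblockers n ⟨i, hi, Relation.TransGen.tail' hp hl⟩
    have hlA : l ∈ A := by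
      by_contra hlA
      exact (hm n hn).2.2 k hk l hlW hlA a b hl
    exact ⟨hlA, fun n' hn' => ((hm m le_rfl).2.1 k hk l hlA n' hn' a b).2
      (((hm m le_rfl).2.1 k hk l hlA n hn a b).1 hl)⟩
  let owner : WFNode Sg → Sg.Pid := fun y => match y with
    | .proc i => i
    | .arc i _ _ => i
  have hpath : ∀ n, m ≤ n → ∀ i ∈ e, ∀ y, Relation.ReflTransGen (x n).WEdge (.proc i) y →
      owner y ∈ A ∧
        ∀ n', m ≤ n' → Relation.ReflTransGen (x n').WEdge (.proc i) y := by
    intro n hn i hi y hy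
    induction hy with
    | refl => exact ⟨heA i hi, fun _ _ => .refl⟩
    | @tail y z hy hyz ih =>
      rcases y with k | ⟨k, a, b⟩
      · obtain ⟨a, b, rfl, hab⟩ := ((x n).wEdge_proc_iff _ _).1 hyz
        exact ⟨ih.1, fun n' hn' => (ih.2 n' hn').tail ⟨rfl, harc' n hn n' hn' k ih.1 a b hab⟩⟩
      · obtain ⟨l, rfl, -⟩ := ((x n).wEdge_arc_iff _ _ _ _).1 hyz
        obtain ⟨hlA, hl⟩ := hblocked n hn i hi k ih.1 a b l hy hyz
        exact ⟨hlA, fun n' hn' => (ih.2 n' hn').tail (hl n' hn')⟩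
  obtain ⟨i, hi, k, a, b, hp, hno⟩ :=
    (supercycle_free _ (h.reachable m)).exists_arc (hmem m)
  have hkA : k ∈ A := (hpath m le_rfl i hi _ hp).1
  have hpk : Relation.ReflTransGen (x m).WEdge (.proc i) (.proc k) ∧ (x m).HasArc k a b := by
    rcases Relation.ReflTransGen.cases_tail hp with heq | ⟨y, hy, hyz⟩
    · exact absurd heq (by simp)
    · rcases y with l | ⟨l, a', b'⟩
      · obtain ⟨rfl, hab⟩ := hyz
        exact ⟨hy, hab⟩
      · exact hyz.elim
  -- A later edge out of this arc would be reachable from the pair, hence already present at `m`.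
  have hen : ∀ n, m ≤ n → (x n).Enabled k := by
    intro n hn
    refine Config.enabled_of_not_wEdge (harc' m le_rfl n hn k hkA a b hpk.2) fun l hl => ?_
    exact hno l ((hblocked n hn i hi k hkA a b l ((hpath m le_rfl i hi _ hp).2 n hn) hl).2 m le_rfl)
  by_cases hke : k ∈ e
  · exact hev k hke (eventually_atTop.2 ⟨m, hen⟩) hcon
  · refine hblk k (eventually_atTop.2 ⟨m, fun n hn => ⟨?_, hen n hn⟩⟩) hkA.2
    -- Since k is outside the pair, the path to it is nontrivial: its last edge shows some arc
    -- waiting for k.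
    rcases Relation.ReflTransGen.cases_tail ((hpath m le_rfl i hi _ hpk.1).2 n hn) with
      heq | ⟨y, -, hyz⟩
    · obtain rfl : k = i := WFNode.proc.inj heq
      exact absurd hi hke
    · rcases y with l | ⟨l, a', b'⟩
      · exact hyz.elim
      · exact (h.reachable n).blk hyz

end IsRun

/-- Fair paths are infinite, so the linear-time modalities become `eventually` and `frequently`
along `atTop`. -/
theorem Fair.frequently_ex {π : LPath (Config D) (Option Sg.Pid)} (hfair : Fair π)
    (hrun : IsRun syn π.st π.lab) (liveness : LivenessCondition D syn)
    (supercycle_free : ∀ r : Config D, r.Reachable syn → r.SupercycleFree)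
    {e : Sym2 Sg.Pid} (hpnd : ∀ n, (π.st n).Pnd e) :
    ∃ᶠ n in atTop, ∃ i ∈ e, π.lab n = some i := by
  have hlen := hfair.2.2.len_eq_top
  have haa : ∀ φ : ℕ → Prop, (∀ᶠ n in atTop, φ n) → π.AlmostAlways φ := by
    intro φ hφ
    obtain ⟨n, hn⟩ := eventually_atTop.1 hφ
    exact ⟨n, by simp [hlen], fun m hm _ => hn m hm⟩
  have hio : ∀ φ : ℕ → Prop, π.InfOften φ → ∃ᶠ n in atTop, φ n := by
    intro φ hφ
    refine frequently_atTop.2 fun n => ?_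
    obtain ⟨m, hm, -, hφm⟩ := hφ n (by simp [hlen])
    exact ⟨m, hm, hφm⟩
  refine hrun.frequently_ex liveness supercycle_free hpnd ?_ ?_
  · intro k hk
    obtain ⟨n, hn⟩ := eventually_atTop.1 hk
    have hmem : k ∈ pathProcs π := by
      obtain ⟨a, b, hab, -⟩ := (hn n le_rfl).2
      exact ⟨n, by simp [hlen], hab.1⟩
    exact (hio _ (hfair.1 k hmem (haa _ hk))).mono fun _ h => h.2
  · intro i hi hen
    obtain ⟨j, rfl⟩ := hi
    refine (hio _ (hfair.2.1 i j ⟨0, by simp, (hpnd 0).1⟩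
      ⟨Or.inl (haa _ hen), haa _ (Eventually.of_forall hpnd)⟩)).mono ?_
    rintro n (h | h)
    · exact ⟨i, Sym2.mem_mk_left i j, h.2⟩
    · exact ⟨j, Sym2.mem_mk_right i j, h.2⟩

theorem IsRun.of_isFullpathFrom {s : Config D} {π : LPath (Config D) (Option Sg.Pid)}
    (hπ : (globalStructure D syn).IsFullpathFrom s π) (hlen : π.len = ⊤) :
    IsRun syn π.st π.lab :=
  ⟨fun n => (hπ.2.1 n (by simp [hlen])).1, fun n => (hπ.2.1 n (by simp [hlen])).2.2⟩

end DynProg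

/-! ### The large model theorem -/

theorem mainTheorem1 (Sg : Signature.{u, v, w, x}) (D : DynamicSpec Sg) (syn : SynthesisMethod Sg)
    (liveness : LivenessCondition D syn)
    (supercycle_free : ∀ r : Config D, r.Reachable syn → r.SupercycleFree)
    (s : Config D) (hs : s.Reachable syn)
    (σ : PairSpec Sg) (hσ : σ ∈ s.inForce) (hpair : σ.pair ∈ s.pairs)
    (f : ACTL Sg.Atom) (hf : f ∈ σ.spec.CL)
    (hsat : (s.prog σ.pair hpair).toKripke.Sat f (s.state σ.pair hpair)) :
    (globalStructure D syn).FairSat Fair f s := by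
  have hpid : Nonempty Sg.Pid := ⟨σ.pair.out.1⟩
  induction f generalizing s with
  | tt => trivial
  | ff => exact hsat
  | atom p | natom p =>
    obtain ⟨hp, hval⟩ := hsat
    exact ⟨σ.pair, hpair, hp, hval⟩
  | and f g ihf ihg =>
    have hsub := ACTL.CL_subset_of_mem hf
    exact ⟨ihf s hs hσ hpair (hsub (Or.inr (Or.inl f.self_mem_CL))) hsat.1,
      ihg s hs hσ hpair (hsub (Or.inr (Or.inr g.self_mem_CL))) hsat.2⟩
  | or f g ihf ihg =>
    have hsub := ACTL.CL_subset_of_mem hf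
    rcases hsat with h | h
    · exact Or.inl (ihf s hs hσ hpair (hsub (Or.inr (Or.inl f.self_mem_CL))) h)
    · exact Or.inr (ihg s hs hσ hpair (hsub (Or.inr (Or.inr g.self_mem_CL))) h)
  | AU f g ihf ihg =>
    have hsub := ACTL.CL_subset_of_mem hf
    have hgCL : g ∈ σ.spec.CL := hsub (Or.inr (Or.inr g.self_mem_CL))
    intro π hπ hfair
    have hlen := hfair.2.2.len_eq_top
    have hrun := IsRun.of_isFullpathFrom hπ hlen
    obtain ⟨rfl, -⟩ := hπ
    have hσn : ∀ n, σ ∈ (π.st n).inForce := fun n => hrun.inForce_mono n.zero_le hσ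
    have hmem : ∀ n, σ.pair ∈ (π.st n).pairs := fun n => hrun.pairs_mono n.zero_le hpair
    have hprog : ∀ n, (π.st n).prog _ (hmem n) = (π.st 0).prog _ hpair :=
      fun n => hrun.prog_eq n.zero_le hpair (hmem n)
    set M := ((π.st 0).prog σ.pair hpair).toKripke
    have hfair_sat_g : ∀ n, M.Sat g ((π.st n).state _ (hmem n)) →
        (globalStructure D syn).FairSat Fair g (π.st n) := fun n hn =>
      ihg (π.st n) (hrun.reachable n) (hσn n) (hmem n) hgCL (by rw [hprog n]; exact hn)
    have hinv : ∀ n, (∀ m < n, ¬ M.Sat g ((π.st m).state _ (hmem m))) →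
        M.Sat (.AU f g) ((π.st n).state _ (hmem n)) := by
      intro n
      induction n with
      | zero => exact fun _ => hsat
      | succ n ih =>
        intro hn
        have h := ih fun m hm => hn m (by omega)
        rcases hrun.pair_step n.zero_le hpair (hmem n) (hmem (n + 1)) with
          ⟨i, -, -, hR⟩ | ⟨-, heq⟩
        · exact h.AU_step (hn n (by omega)) hR
        · rw [heq]
          exact h
    -- Here fairness enters: without g the eventuality would be pending throughout, so the pair
    -- executes infinitely often and its projection is a fullpath of `M`.
    have hex : ∃ n, M.Sat g ((π.st n).state _ (hmem n)) := by
      by_contra! hcon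
      have hfreq := hfair.frequently_ex hrun liveness supercycle_free (e := σ.pair) fun n => by
        refine ⟨hmem n, σ, hσn n, rfl, g, hgCL, ?_, ?_⟩
        · rw [hprog n]
          exact hcon n
        · rw [hprog n]
          exact (hinv n fun m _ => hcon m).AF_of_AU
      obtain ⟨ρ, -, hρ, -, hst, -⟩ :=
        hrun.exists_projection hpair (Filter.frequently_atTop.1 hfreq)
      obtain ⟨n, -, hgn, -⟩ := hsat ρ hρ trivial
      obtain ⟨k, -, -, hk, heq⟩ := hst n
      rw [heq] at hgn
      exact hcon k hgn
    classical
    -- The least position is taken for satisfaction of g in the pair-structure, not for fair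
    -- satisfaction: the induction hypothesis transfers truth in one direction only.
    refine ⟨Nat.find hex, by simp [hlen], hfair_sat_g _ (Nat.find_spec hex), fun m hm => ?_⟩
    refine ihf (π.st m) (hrun.reachable m) (hσn m) (hmem m)
      (hsub (Or.inr (Or.inl f.self_mem_CL))) ?_
    rw [hprog m]
    exact (hinv m fun r hr => Nat.find_min hex (hr.trans hm)).AU_now (Nat.find_min hex hm)
  | AW f g ihf ihg =>
    have hsub := ACTL.CL_subset_of_mem hf
    intro π hπ hfair n _ hng
    have hrun := IsRun.of_isFullpathFrom hπ hfair.2.2.len_eq_top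
    obtain ⟨rfl, -⟩ := hπ
    have hσn : ∀ n, σ ∈ (π.st n).inForce := fun n => hrun.inForce_mono n.zero_le hσ
    have hmem : ∀ n, σ.pair ∈ (π.st n).pairs := fun n => hrun.pairs_mono n.zero_le hpair
    have hprog : ∀ n, (π.st n).prog _ (hmem n) = (π.st 0).prog _ hpair :=
      fun n => hrun.prog_eq n.zero_le hpair (hmem n)
    set M := ((π.st 0).prog σ.pair hpair).toKripke
    -- Contraposition of the induction hypothesis: fair failure of g entails its failure in the
    -- pair-structure.
    have hng' : ∀ m ≤ n, ¬ M.Sat g ((π.st m).state _ (hmem m)) := fun m hm hg =>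
      hng m hm (ihg (π.st m) (hrun.reachable m) (hσn m) (hmem m)
        (hsub (Or.inr (Or.inr g.self_mem_CL))) (by rw [hprog m]; exact hg))
    have hinv : ∀ m ≤ n, M.Sat (.AW f g) ((π.st m).state _ (hmem m)) := by
      intro m
      induction m with
      | zero => exact fun _ => hsat
      | succ m ih =>
        intro hm
        have h := ih (by omega)
        rcases hrun.pair_step m.zero_le hpair (hmem m) (hmem (m + 1)) with
          ⟨i, -, -, hR⟩ | ⟨-, heq⟩
        · exact h.AW_step (hng' m (by omega)) hR
        · rw [heq]
          exact h
    refine ihf (π.st n) (hrun.reachable n) (hσn n) (hmem n)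
      (hsub (Or.inr (Or.inl f.self_mem_CL))) ?_
    rw [hprog n]
    exact (hinv n le_rfl).AW_now (hng' n le_rfl)
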